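/- Let $W^1,W^2,W^3,W^4$ be disjoint finite sets, $W=W^1\cup W^2\cup W^3\cup W^4$, let $W^4_I\subseteq W^4$, and let $W_I=W^1\cup W^2\cup W^4_I$. For $I\subseteq W$ (or $I \subseteq W^4$) let $\mathbb{M}^{I}$ denote the set of real vectors indexed by $W$ (respectively $W^4$) whose entries indexed by $I$ are integers. Let $m_1,m_2\ge 0$ and let $$P=\{(x,y,z,\omega)\in\mathbb{R}^{W^1}\times\mathbb{R}^{W^2}\times\mathbb{R}^{W^3}\times\mathbb{R}^{W^4} : Ax+By+Cz=b,\ Dx+Ey+F\omega=g,\ \ell\le(x,y,z,\omega)\le u\},$$ where $A\in\mathbb{Z}^{m_1\times W^1}$, $B\in\mathbb{Z}^{m_1\times W^2}$, $C\in\mathbb{Z}^{m_1\times W^3}$, $b\in\mathbb{Z}^{m_1}$, $D\in\mathbb{Q}^{m_2\times W^1}$, $E\in\mathbb{Q}^{m_2\times W^2}$, $F\in\mathbb{Q}^{m_2\times W^4}$, $g\in\mathbb{R}^{m_2}$, $\ell\in(\mathbb{Q}\cup\{-\infty\})^{W}$, $u\in(\mathbb{Q}\cup\{+\infty\})^{W}$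 and $\ell\le u$. Suppose that for some $k\le|W^2|$ there are matrices $S\in\mathbb{Z}^{m_1\times W^2}$, $U\in\mathbb{Z}^{m_1\times k}$, $T\in\mathbb{Z}^{k\times W^2}$ and $R\in\mathbb{Q}^{m_2\times k}$ such that $B=S+UT$, $E=RT$, and the matrix $$\begin{bmatrix} S & C\\ T & 0\end{bmatrix}$$ is totally unimodular, and suppose that every finite entry of $\ell$ and $u$ indexed by an element of $W_I\cup W^3$ is an integer. Then for every $d=(d_{W^1},d_T,d_{W^4_I})\in\mathbb{Z}^{W^1}\times\mathbb{Z}^k\times\mathbb{Z}^{W^4_I}$ the affine fiber $$H_d=\{(x,y,z,\omega)\in P : x=d_{W^1},\ Ty=d_T,\ \omega_{W^4_I}=d_{W^4_I}\}$$ satisfies $$H_d=\operatorname{conv}(H_d\cap\mathbb{M}^{W_I})=\operatorname{conv}(H_d\cap\mathbb{M}^{W_I\cup W^3}).$$ Moreover, $$\operatorname{conv}(P\cap\mathbb{M}^{W_I})=\operatorname{conv}(P\cap\mathbb{M}^{W_I\cup W^3})=\operatorname{conv}\bigl(\{(x,y,z,\omega)\in P : x\in\mathbb{Z}^{W^1},\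 Ty\in\mathbb{Z}^k,\ \omega\in\mathbb{M}^{W^4_I}\}\bigr).$$ -/

import Mathlib

open scoped Matrix

/-- The set `M^I`: the vectors in `ℝ^W` whose entries indexed by `I` are integers. -/
def mixedIntegerSet {W : Type*} (I : Set W) : Set (W → ℝ) :=
  {p | ∀ w ∈ I, ∃ n : ℤ, p w = n}

/-- A vector of lower bounds (rational or `-∞`) is integral on `I`; infinite entries are regarded
as integral. -/
def LowerIntegralOn {W : Type*} (ℓ : W → WithBot ℚ) (I : Set W) : Prop :=
  ∀ w ∈ I, ∀ q : ℚ, ℓ w = (q : WithBot ℚ) → ∃ n : ℤ, q = n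

/-- A vector of upper bounds (rational or `+∞`) is integral on `I`; infinite entries are regarded
as integral. -/
def UpperIntegralOn {W : Type*} (u : W → WithTop ℚ) (I : Set W) : Prop :=
  ∀ w ∈ I, ∀ q : ℚ, u w = (q : WithTop ℚ) → ∃ n : ℤ, q = n

/-- The index set `W = W¹ ∪ W² ∪ W³ ∪ W⁴` (disjoint union) of all variables `(x, y, z, ω)`. -/
abbrev Vars (W1 W2 W3 W4 : Type*) := W1 ⊕ W2 ⊕ W3 ⊕ W4

section Parts

variable {W1 W2 W3 W4 : Type*}

/-- The block `x` of `(x, y, z, ω)`. -/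
def xPart (p : Vars W1 W2 W3 W4 → ℝ) : W1 → ℝ := fun w => p (Sum.inl w)

/-- The block `y` of `(x, y, z, ω)`. -/
def yPart (p : Vars W1 W2 W3 W4 → ℝ) : W2 → ℝ := fun w => p (Sum.inr (Sum.inl w))

/-- The block `z` of `(x, y, z, ω)`. -/
def zPart (p : Vars W1 W2 W3 W4 → ℝ) : W3 → ℝ := fun w => p (Sum.inr (Sum.inr (Sum.inl w)))

/-- The block `ω` of `(x, y, z, ω)`. -/
def ωPart (p : Vars W1 W2 W3 W4 → ℝ) : W4 → ℝ := fun w => p (Sum.inr (Sum.inr (Sum.inr w)))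

end Parts

/-- The data of a mixed-integer linear program in the variables `(x, y, z, ω)` with equations
`A x + B y + C z = b` and `D x + E y + F ω = g` and bounds `ℓ ≤ (x, y, z, ω) ≤ u`. -/
structure BlockMILP (W1 W2 W3 W4 : Type*) (m₁ m₂ : ℕ) where
  A : Matrix (Fin m₁) W1 ℤ
  B : Matrix (Fin m₁) W2 ℤ
  C : Matrix (Fin m₁) W3 ℤ
  b : Fin m₁ → ℤ
  D : Matrix (Fin m₂) W1 ℚ
  E : Matrix (Fin m₂) W2 ℚ
  F : Matrix (Fin m₂) W4 ℚ
  g : Fin m₂ → ℝ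
  /-- lower bounds; `⊥` means `-∞` -/
  ℓ : Vars W1 W2 W3 W4 → WithBot ℚ
  /-- upper bounds; `⊤` means `+∞` -/
  u : Vars W1 W2 W3 W4 → WithTop ℚ
  ℓ_le_u : ∀ w, ∀ q r : ℚ, ℓ w = (q : WithBot ℚ) → u w = (r : WithTop ℚ) → q ≤ r
  /-- the set `W⁴_I ⊆ W⁴` of the integer variables among the `ω`-variables -/
  W4I : Set W4

namespace BlockMILP

variable {W1 W2 W3 W4 : Type*} {m₁ m₂ : ℕ}

/-- The set `W_I = W¹ ∪ W² ∪ W⁴_I` of integer variables. -/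
def intVars (M : BlockMILP W1 W2 W3 W4 m₁ m₂) : Set (Vars W1 W2 W3 W4) :=
  {w | (∃ i : W1, w = Sum.inl i) ∨ (∃ i : W2, w = Sum.inr (Sum.inl i)) ∨
    (∃ i ∈ M.W4I, w = Sum.inr (Sum.inr (Sum.inr i)))}

/-- The set `W³` of the `z`-variables, as a subset of all variables. -/
def zVars (_M : BlockMILP W1 W2 W3 W4 m₁ m₂) : Set (Vars W1 W2 W3 W4) :=
  {w | ∃ i : W3, w = Sum.inr (Sum.inr (Sum.inl i))}

variable [Fintype W1] [Fintype W2] [Fintype W3] [Fintype W4]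

/-- The feasible region `P` of the linear relaxation. -/
def P (M : BlockMILP W1 W2 W3 W4 m₁ m₂) : Set (Vars W1 W2 W3 W4 → ℝ) :=
  {p |
    M.A.map (Int.cast : ℤ → ℝ) *ᵥ xPart p + M.B.map (Int.cast : ℤ → ℝ) *ᵥ yPart p
      + M.C.map (Int.cast : ℤ → ℝ) *ᵥ zPart p = (fun i => (M.b i : ℝ)) ∧
    M.D.map (Rat.cast : ℚ → ℝ) *ᵥ xPart p + M.E.map (Rat.cast : ℚ → ℝ) *ᵥ yPart p
      + M.F.map (Rat.cast : ℚ → ℝ) *ᵥ ωPart p = M.g ∧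
    (∀ w, ∀ q : ℚ, M.ℓ w = (q : WithBot ℚ) → (q : ℝ) ≤ p w) ∧
    (∀ w, ∀ q : ℚ, M.u w = (q : WithTop ℚ) → p w ≤ (q : ℝ))}

/-- The affine fiber `H_d`: the points of `P` with `x = d_{W¹}`, `T y = d_T` and
`ω_{W⁴_I} = d_{W⁴_I}`. -/
def fiber (M : BlockMILP W1 W2 W3 W4 m₁ m₂) {k : ℕ} (T : Matrix (Fin k) W2 ℤ)
    (dx : W1 → ℤ) (dT : Fin k → ℤ) (dω : M.W4I → ℤ) : Set (Vars W1 W2 W3 W4 → ℝ) :=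
  {p | p ∈ M.P ∧ (∀ i, xPart p i = dx i) ∧
    (∀ j, (T.map (Int.cast : ℤ → ℝ) *ᵥ yPart p) j = dT j) ∧
    (∀ i : M.W4I, ωPart p i = dω i)}

/-- The points of `P` with `x` integral, `T y` integral and `ω ∈ M^{W⁴_I}`. -/
def reformulation (M : BlockMILP W1 W2 W3 W4 m₁ m₂) {k : ℕ} (T : Matrix (Fin k) W2 ℤ) :
    Set (Vars W1 W2 W3 W4 → ℝ) :=
  {p | p ∈ M.P ∧ (∀ i, ∃ n : ℤ, xPart p i = n) ∧
    (∀ j, ∃ n : ℤ, (T.map (Int.cast : ℤ → ℝ) *ᵥ yPart p) j = n) ∧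
    ωPart p ∈ mixedIntegerSet M.W4I}

end BlockMILP

/-!
The heart of the matter is that every point of a fiber is a convex combination of points of the same
fiber whose blocks `y` and `z` are integral.

Fix a point of the fiber. Since `B = S + U T` and `E = R T`, once `x`, `ω` and `T y` are kept fixed,
the equations constrain `(y, z)` only through the product of the totally
unimodular matrix `[S C; T 0]` with `(y, z)`, and this product is integral
(`BlockMILP.replaceYZ_mem_fiber`). So only `(y, z)` has to be moved. By
`Matrix.IsTotallyUnimodular.mem_convexHull_integral`, a vector `w` with integral image under a
totally unimodular `N` is a convex combination of integral vectors with the same image and with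
entries between the floor and the ceiling of those of `w`; as the finite bounds on `y` and `z` are
integral, such vectors still satisfy them, and infinite bounds play no role.

That lemma is proved by induction on the number of fractional entries of `w`. By Cramer's rule and
total unimodularity the columns of `N` at these entries are dependent, so `w` can be moved in two
opposite directions inside the kernel of `N` until some fractional entry becomes integral
(`exists_pos_add_smul_fract_ssubset`); `w` lies between the two end points.

The equalities for the fibers follow because a fiber is convex, and those for `P` because the set
where `x`, `T y` and the chosen entries of `ω` are integral is the union of the fibers and contains
all points of `P` that are integral on `W_I`.
-/

/-! ### Totally unimodular systems with integral right-hand side -/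

namespace Matrix

/-- A real matrix with trivial kernel has a nonsingular square submatrix that uses all columns. -/
lemma exists_submatrix_det_ne_zero {m J : Type*} [Fintype m] [Fintype J] [DecidableEq J]
    (A : Matrix m J ℝ) (hA : ∀ v, A *ᵥ v = 0 → v = 0) :
    ∃ r : J → m, (A.submatrix r id).det ≠ 0 := by
  have hrank : A.rank = Fintype.card J := by
    have hinj : Function.Injective A.mulVecLin := by
      rw [← LinearMap.ker_eq_bot, LinearMap.ker_eq_bot']
      exact fun v hv => hA v hv
    rw [Matrix.rank, LinearMap.finrank_range_of_inj hinj, Module.finrank_fintype_fun_eq_card]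
  obtain ⟨κ, a, ha, hspan, hli⟩ := exists_linearIndependent' ℝ A.row
  have : Fintype κ := Fintype.ofInjective a ha
  have hcard : Fintype.card J = Fintype.card κ := by
    rw [← hrank, A.rank_eq_finrank_span_row, ← hspan, finrank_span_eq_card hli]
  have e : J ≃ κ := Fintype.equivOfCardEq hcard
  refine ⟨a ∘ e, ?_⟩
  have hrows : LinearIndependent ℝ (A.submatrix (a ∘ e) id).row := hli.comp e e.injective
  exact ((isUnit_iff_isUnit_det _).mp (linearIndependent_rows_iff_isUnit.mp hrows)).ne_zero

/-- An integral linear system with invertible integral matrix has only integral real solutions. -/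
lemma exists_int_of_mulVec_int {J : Type*} [Fintype J] [DecidableEq J] (N : Matrix J J ℤ)
    (hN : IsUnit N.det) (x : J → ℝ)
    (hx : ∀ i, ∃ n : ℤ, (N.map (Int.cast : ℤ → ℝ) *ᵥ x) i = n) (j : J) :
    ∃ n : ℤ, x j = n := by
  choose c hc using hx
  have h1 : N⁻¹.map (Int.cast : ℤ → ℝ) * N.map (Int.cast : ℤ → ℝ) = 1 := by
    have h := congrArg (fun L => L.map (Int.castRingHom ℝ)) (N.nonsing_inv_mul hN)
    rw [Matrix.map_mul, Matrix.map_one _ (map_zero _) (map_one _)] at h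
    exact h
  refine ⟨(N⁻¹ *ᵥ c) j, ?_⟩
  have h2 : x = N⁻¹.map (Int.cast : ℤ → ℝ) *ᵥ (N.map (Int.cast : ℤ → ℝ) *ᵥ x) := by
    rw [mulVec_mulVec, h1, one_mulVec]
  rw [h2, funext hc]
  simp [mulVec, dotProduct]

/-- If `N` is totally unimodular and `N w` is integral while `w` is not, the columns of `N` at the
fractional entries of `w` are dependent: otherwise these entries would solve a system with
integral right-hand side and a coefficient matrix of determinant `±1`. -/
lemma IsTotallyUnimodular.exists_mulVec_eq_zero {m n : Type*} [Fintype m] [Fintype n]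
    {N : Matrix m n ℤ} (hN : N.IsTotallyUnimodular) {w : n → ℝ}
    (hw : ∀ i, ∃ c : ℤ, (N.map (Int.cast : ℤ → ℝ) *ᵥ w) i = c)
    {j₀ : n} (hj₀ : Int.fract (w j₀) ≠ 0) :
    ∃ v : n → ℝ, v ≠ 0 ∧ N.map (Int.cast : ℤ → ℝ) *ᵥ v = 0 ∧
      ∀ j, Int.fract (w j) = 0 → v j = 0 := by
  classical
  by_contra! hcon
  let J := {j // Int.fract (w j) ≠ 0}
  -- sums over `n` of vectors supported on `J` are sums over `J`
  have hsum : ∀ v : n → ℝ, (∀ j, Int.fract (w j) = 0 → v j = 0) → ∀ i,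
      (N.map (Int.cast : ℤ → ℝ) *ᵥ v) i
        = ((N.submatrix id ((↑) : J → n)).map (Int.cast : ℤ → ℝ) *ᵥ (fun j : J => v j)) i := by
    intro v hv i
    simp only [mulVec, dotProduct, map_apply, submatrix_apply, id]
    rw [← Fintype.sum_subtype_add_sum_subtype (fun j => Int.fract (w j) ≠ 0)]
    refine add_eq_left.mpr (Finset.sum_eq_zero fun j _ => ?_)
    rw [hv j (not_not.mp j.2), mul_zero]
  obtain ⟨r, hr⟩ := exists_submatrix_det_ne_zero
    ((N.submatrix id ((↑) : J → n)).map (Int.cast : ℤ → ℝ)) (by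
      intro v hv
      by_contra hv0
      let v' : n → ℝ := fun j => if h : Int.fract (w j) ≠ 0 then v ⟨j, h⟩ else 0
      have hv' : (fun j : J => v' j) = v := funext fun j => dif_pos j.2
      have hsupp : ∀ j, Int.fract (w j) = 0 → v' j = 0 := fun j hj => dif_neg (not_not.mpr hj)
      obtain ⟨j, hj, hj'⟩ := hcon v' (fun h0 => hv0 (by rw [← hv', h0]; rfl))
        (funext fun i => by rw [hsum v' hsupp, hv', hv])
      exact hj' (hsupp j hj))
  have hunit : IsUnit (N.submatrix r ((↑) : J → n)).det := by
    have hdet : (N.submatrix r ((↑) : J → n)).det ≠ 0 := by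
      intro h0
      apply hr
      have h := (Int.castRingHom ℝ).map_det (N.submatrix r ((↑) : J → n))
      rw [h0, map_zero] at h
      exact h.symm
    -- the matrix is square over `J`, while total unimodularity speaks of index types `Fin k`
    have hmem := N.isTotallyUnimodular_iff.mp hN (Fintype.card J)
      (r ∘ (Fintype.equivFin J).symm) ((↑) ∘ (Fintype.equivFin J).symm)
    rw [← submatrix_submatrix, det_submatrix_equiv_self] at hmem
    obtain ⟨s, hs⟩ := hmem
    rw [← hs] at hdet ⊢
    clear hs
    rcases s with _ | _ | _ <;> simp at hdet ⊢
  have hfract : ∀ i, ∃ c : ℤ,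
      (N.map (Int.cast : ℤ → ℝ) *ᵥ fun j => Int.fract (w j)) i = c := by
    intro i
    obtain ⟨c, hc⟩ := hw i
    refine ⟨c - (N *ᵥ fun j => ⌊w j⌋) i, ?_⟩
    push_cast
    rw [← hc]
    simp only [mulVec, dotProduct, map_apply, ← Int.self_sub_floor, mul_sub,
      Finset.sum_sub_distrib]
    push_cast
    rfl
  obtain ⟨c, hc⟩ := exists_int_of_mulVec_int (N.submatrix r ((↑) : J → n)) hunit
    (fun j : J => Int.fract (w j)) (fun i => by
      obtain ⟨c, hc⟩ := hfract (r i)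
      rw [hsum _ fun _ hj => hj] at hc
      exact ⟨c, hc⟩) ⟨j₀, hj₀⟩
  refine hj₀ ?_
  have hc' : Int.fract (w j₀) = c := hc
  rw [← Int.fract_fract, hc', Int.fract_intCast]

end Matrix

/-- Moving `w` along a nonzero direction `v` supported on its fractional entries, up to the first
time an entry becomes integral, stays in the smallest integral box around `w` and leaves fewer
fractional entries. -/
lemma exists_pos_add_smul_fract_ssubset {n : Type*} [Fintype n] {w v : n → ℝ} (hv : v ≠ 0)
    (hvw : ∀ j, Int.fract (w j) = 0 → v j = 0) :
    ∃ t : ℝ, 0 < t ∧ (∀ j, (⌊w j⌋ : ℝ) ≤ (w + t • v) j ∧ (w + t • v) j ≤ ⌈w j⌉) ∧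
      {j | Int.fract ((w + t • v) j) ≠ 0} ⊂ {j | Int.fract (w j) ≠ 0} := by
  classical
  -- `τ j` is the time at which entry `j` reaches the bound it is moving towards
  let τ : n → ℝ := fun j => if 0 < v j then (⌈w j⌉ - w j) / v j else (⌊w j⌋ - w j) / v j
  obtain ⟨j₀, hj₀⟩ := Function.ne_iff.mp hv
  obtain ⟨i, hi, hmin⟩ := (Finset.univ.filter fun j => v j ≠ 0).exists_min_image τ
    ⟨j₀, by simpa using hj₀⟩
  have hi : v i ≠ 0 := by simpa using hi
  have hmin : ∀ j, v j ≠ 0 → τ i ≤ τ j := fun j hj => hmin j (by simpa using hj)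
  have hlt : ∀ j, v j ≠ 0 → (⌊w j⌋ : ℝ) < w j ∧ w j < ⌈w j⌉ := by
    intro j hj
    have hf : Int.fract (w j) ≠ 0 := fun h => hj (hvw j h)
    have hfl : (⌊w j⌋ : ℝ) ≠ w j := fun h => hf (by rw [Int.fract, h, sub_self])
    refine ⟨lt_of_le_of_ne (Int.floor_le _) hfl, lt_of_le_of_ne (Int.le_ceil _) fun h => hf ?_⟩
    rw [h, Int.fract_intCast]
  have hpos : 0 < τ i := by
    obtain ⟨h1, h2⟩ := hlt i hi
    by_cases hs : 0 < v i
    · simp only [τ, if_pos hs]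
      exact div_pos (sub_pos.mpr h2) hs
    · simp only [τ, if_neg hs]
      exact div_pos_of_neg_of_neg (sub_neg.mpr h1) (lt_of_le_of_ne (not_lt.mp hs) hi)
  have hint : Int.fract ((w + τ i • v) i) = 0 := by
    by_cases hs : 0 < v i
    · simp [τ, if_pos hs, div_mul_cancel₀ _ hi]
    · simp [τ, if_neg hs, div_mul_cancel₀ _ hi]
  refine ⟨τ i, hpos, fun j => ?_, ?_, ?_⟩
  · simp only [Pi.add_apply, Pi.smul_apply, smul_eq_mul]
    by_cases hj : v j = 0
    · simp [hj, Int.floor_le, Int.le_ceil]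
    obtain ⟨h1, h2⟩ := hlt j hj
    have hle := hmin j hj
    by_cases hs : 0 < v j
    · simp only [τ, if_pos hs] at hle
      rw [le_div_iff₀ hs] at hle
      exact ⟨by nlinarith [mul_pos hpos hs], by linarith⟩
    · have hs' : v j < 0 := lt_of_le_of_ne (not_lt.mp hs) hj
      rw [show τ j = (⌊w j⌋ - w j) / v j from if_neg hs, le_div_iff_of_neg hs'] at hle
      exact ⟨by linarith, by nlinarith [mul_neg_of_pos_of_neg hpos hs']⟩
  · intro j hj hj'
    refine hj ?_
    simpa [hvw j hj'] using hj'
  · intro h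
    exact h (show i ∈ {j | Int.fract (w j) ≠ 0} from fun h0 => hi (hvw i h0)) hint

/-- A form of the Hoffman–Kruskal theorem: if `N` is totally unimodular and `N w` is integral, then
`w` is a convex combination of integral points with the same image under `N`, lying in the
smallest integral box around `w`. The box makes the polyhedron bounded, so that no recession
directions intervene. -/
lemma Matrix.IsTotallyUnimodular.mem_convexHull_integral {m n : Type*} [Fintype m] [Fintype n]
    {N : Matrix m n ℤ} (hN : N.IsTotallyUnimodular) (w : n → ℝ)
    (hw : ∀ i, ∃ c : ℤ, (N.map (Int.cast : ℤ → ℝ) *ᵥ w) i = c) :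
    w ∈ convexHull ℝ {p : n → ℝ | (∀ j, ∃ c : ℤ, p j = c) ∧
      N.map (Int.cast : ℤ → ℝ) *ᵥ p = N.map (Int.cast : ℤ → ℝ) *ᵥ w ∧
      ∀ j, (⌊w j⌋ : ℝ) ≤ p j ∧ p j ≤ ⌈w j⌉} := by
  -- induction on the number of fractional entries
  induction hk : {j | Int.fract (w j) ≠ 0}.ncard using Nat.strong_induction_on generalizing w with
  | _ k ih =>
  by_cases hfr : ∃ j, Int.fract (w j) ≠ 0
  · obtain ⟨j₀, hj₀⟩ := hfr
    obtain ⟨v, hv, hNv, hvw⟩ := hN.exists_mulVec_eq_zero hw hj₀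
    -- the endpoint of a move along the kernel lies in the hull by the induction hypothesis
    have key : ∀ v : n → ℝ, v ≠ 0 → N.map (Int.cast : ℤ → ℝ) *ᵥ v = 0 →
        (∀ j, Int.fract (w j) = 0 → v j = 0) → ∃ t : ℝ, 0 < t ∧
        w + t • v ∈ convexHull ℝ {p : n → ℝ | (∀ j, ∃ c : ℤ, p j = c) ∧
          N.map (Int.cast : ℤ → ℝ) *ᵥ p = N.map (Int.cast : ℤ → ℝ) *ᵥ w ∧
          ∀ j, (⌊w j⌋ : ℝ) ≤ p j ∧ p j ≤ ⌈w j⌉} := by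
      intro v hv hNv hvw
      obtain ⟨t, ht, hbox, hss⟩ := exists_pos_add_smul_fract_ssubset hv hvw
      have hNt : N.map (Int.cast : ℤ → ℝ) *ᵥ (w + t • v) = N.map (Int.cast : ℤ → ℝ) *ᵥ w := by
        rw [Matrix.mulVec_add, Matrix.mulVec_smul, hNv, smul_zero, add_zero]
      refine ⟨t, ht, convexHull_mono ?_
        (ih _ (hk ▸ Set.ncard_lt_ncard hss (Set.toFinite _)) _ (hNt.symm ▸ hw) rfl)⟩
      rintro p ⟨hp, hpN, hpb⟩
      refine ⟨hp, hpN.trans hNt, fun j => ⟨?_, ?_⟩⟩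
      · exact le_trans (Int.cast_le.mpr (Int.le_floor.mpr (hbox j).1)) (hpb j).1
      · exact (hpb j).2.trans (Int.cast_le.mpr (Int.ceil_le.mpr (hbox j).2))
    obtain ⟨s, hs, hws⟩ := key v hv hNv hvw
    obtain ⟨t, ht, hwt⟩ := key (-v) (neg_ne_zero.mpr hv) (by rw [Matrix.mulVec_neg, hNv, neg_zero])
      (fun j hj => by simp [hvw j hj])
    have hst : 0 < s + t := add_pos hs ht
    have hconv := (convex_convexHull ℝ {p : n → ℝ | (∀ j, ∃ c : ℤ, p j = c) ∧
      N.map (Int.cast : ℤ → ℝ) *ᵥ p = N.map (Int.cast : ℤ → ℝ) *ᵥ w ∧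
      ∀ j, (⌊w j⌋ : ℝ) ≤ p j ∧ p j ≤ ⌈w j⌉}) hws hwt
      (div_pos ht hst).le (div_pos hs hst).le (by field_simp; ring)
    convert hconv using 1
    ext j
    simp only [Pi.add_apply, Pi.smul_apply, Pi.neg_apply, smul_eq_mul]
    field_simp
    ring
  · push Not at hfr
    refine subset_convexHull ℝ _ ⟨fun j => ⟨⌊w j⌋, ?_⟩, rfl, fun j => ⟨Int.floor_le _, Int.le_ceil _⟩⟩
    rw [← Int.floor_add_fract (w j), hfr j]
    simp

/-! ### Fibers of the mixed-integer program -/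

namespace BlockMILP

variable {W1 W2 W3 W4 : Type*} {m₁ m₂ : ℕ}
variable [Fintype W1] [Fintype W2] [Fintype W3] [Fintype W4]

lemma convex_P (M : BlockMILP W1 W2 W3 W4 m₁ m₂) : Convex ℝ M.P := by
  rintro p ⟨hp1, hp2, hp3, hp4⟩ q ⟨hq1, hq2, hq3, hq4⟩ a b ha hb hab
  have hx : xPart (a • p + b • q) = a • xPart p + b • xPart q := rfl
  have hy : yPart (a • p + b • q) = a • yPart p + b • yPart q := rfl
  have hz : zPart (a • p + b • q) = a • zPart p + b • zPart q := rfl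
  have hω : ωPart (a • p + b • q) = a • ωPart p + b • ωPart q := rfl
  refine ⟨?_, ?_, fun w r hr => ?_, fun w r hr => ?_⟩
  · have h := congrArg₂ (fun c d => a • c + b • d) hp1 hq1
    simp only [← add_smul, hab, one_smul] at h
    rw [← h, hx, hy, hz]
    simp only [Matrix.mulVec_add, Matrix.mulVec_smul, smul_add]
    abel
  · have h := congrArg₂ (fun c d => a • c + b • d) hp2 hq2
    simp only [← add_smul, hab, one_smul] at h
    rw [← h, hx, hy, hω]
    simp only [Matrix.mulVec_add, Matrix.mulVec_smul, smul_add]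
    abel
  · exact convex_Ici (r : ℝ) (hp3 w r hr) (hq3 w r hr) ha hb hab
  · exact convex_Iic (r : ℝ) (hp4 w r hr) (hq4 w r hr) ha hb hab

lemma convex_fiber (M : BlockMILP W1 W2 W3 W4 m₁ m₂) {k : ℕ} (T : Matrix (Fin k) W2 ℤ)
    (dx : W1 → ℤ) (dT : Fin k → ℤ) (dω : M.W4I → ℤ) : Convex ℝ (M.fiber T dx dT dω) := by
  rintro p ⟨hp, hpx, hpT, hpω⟩ q ⟨hq, hqx, hqT, hqω⟩ a b ha hb hab
  refine ⟨M.convex_P hp hq ha hb hab, fun i => ?_, fun j => ?_, fun i => ?_⟩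
  · change a * xPart p i + b * xPart q i = _
    rw [hpx, hqx, ← add_mul, hab, one_mul]
  · have hy : yPart (a • p + b • q) = a • yPart p + b • yPart q := rfl
    rw [hy, Matrix.mulVec_add, Matrix.mulVec_smul, Matrix.mulVec_smul]
    change a * _ + b * _ = _
    rw [hpT, hqT, ← add_mul, hab, one_mul]
  · change a * ωPart p i + b * ωPart q i = _
    rw [hpω, hqω, ← add_mul, hab, one_mul]

/-- The point `(x, y', z', ω)` obtained from `(x, y, z, ω)` by replacing the blocks `y` and `z`. -/
def replaceYZ (p : Vars W1 W2 W3 W4 → ℝ) (v : W2 ⊕ W3 → ℝ) : Vars W1 W2 W3 W4 → ℝ :=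
  Sum.elim (xPart p) (Sum.elim (v ∘ Sum.inl) (Sum.elim (v ∘ Sum.inr) (ωPart p)))

/-- Since `B = S + U T` and `E = R T`, on a point with fixed `x` and `ω` both systems of equations
see `(y, z)` only through `S y + C z` and `T y`. Integral bounds are respected because the new
entries stay between the floor and the ceiling of the old ones. -/
lemma replaceYZ_mem_fiber (M : BlockMILP W1 W2 W3 W4 m₁ m₂) {k : ℕ}
    {S : Matrix (Fin m₁) W2 ℤ} {U : Matrix (Fin m₁) (Fin k) ℤ}
    {T : Matrix (Fin k) W2 ℤ} {R : Matrix (Fin m₂) (Fin k) ℚ}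
    (hB : M.B = S + U * T) (hE : M.E = R * T.map (Int.cast : ℤ → ℚ))
    (hℓ : LowerIntegralOn M.ℓ (M.intVars ∪ M.zVars))
    (hu : UpperIntegralOn M.u (M.intVars ∪ M.zVars))
    {dx : W1 → ℤ} {dT : Fin k → ℤ} {dω : M.W4I → ℤ}
    {p : Vars W1 W2 W3 W4 → ℝ} (hp : p ∈ M.fiber T dx dT dω) {v : W2 ⊕ W3 → ℝ}
    (hS : S.map (Int.cast : ℤ → ℝ) *ᵥ (v ∘ Sum.inl) + M.C.map (Int.cast : ℤ → ℝ) *ᵥ (v ∘ Sum.inr)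
      = S.map (Int.cast : ℤ → ℝ) *ᵥ yPart p + M.C.map (Int.cast : ℤ → ℝ) *ᵥ zPart p)
    (hT : T.map (Int.cast : ℤ → ℝ) *ᵥ (v ∘ Sum.inl) = T.map (Int.cast : ℤ → ℝ) *ᵥ yPart p)
    (hv : ∀ j, (⌊Sum.elim (yPart p) (zPart p) j⌋ : ℝ) ≤ v j ∧
      v j ≤ ⌈Sum.elim (yPart p) (zPart p) j⌉) :
    replaceYZ p v ∈ M.fiber T dx dT dω := by
  obtain ⟨⟨hp1, hp2, hp3, hp4⟩, hpx, hpT, hpω⟩ := hp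
  have hx : xPart (replaceYZ p v) = xPart p := rfl
  have hy : yPart (replaceYZ p v) = v ∘ Sum.inl := rfl
  have hz : zPart (replaceYZ p v) = v ∘ Sum.inr := rfl
  have hω : ωPart (replaceYZ p v) = ωPart p := rfl
  have hBR : M.B.map (Int.cast : ℤ → ℝ) = S.map (Int.cast : ℤ → ℝ)
      + U.map (Int.cast : ℤ → ℝ) * T.map (Int.cast : ℤ → ℝ) := by
    ext i j
    simp [hB, Matrix.mul_apply]
  have hER : M.E.map (Rat.cast : ℚ → ℝ)
      = R.map (Rat.cast : ℚ → ℝ) * T.map (Int.cast : ℤ → ℝ) := by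
    ext i j
    simp [hE, Matrix.mul_apply]
  refine ⟨⟨?_, ?_, ?_, ?_⟩, hpx, ?_, hpω⟩
  · rw [← hp1, hx, hy, hz, hBR]
    simp only [Matrix.add_mulVec, ← Matrix.mulVec_mulVec, hT]
    linear_combination hS
  · rw [← hp2, hx, hy, hω, hER]
    simp only [← Matrix.mulVec_mulVec, hT]
  · rintro (i | i | i | i) q hq
    · exact hp3 _ q hq
    · obtain ⟨n, rfl⟩ := hℓ _ (Or.inl (Or.inr (Or.inl ⟨i, rfl⟩))) q hq
      have h := hp3 _ _ hq
      rw [Rat.cast_intCast] at h ⊢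
      exact (Int.cast_le.mpr (Int.le_floor.mpr h)).trans (hv (Sum.inl i)).1
    · obtain ⟨n, rfl⟩ := hℓ _ (Or.inr ⟨i, rfl⟩) q hq
      have h := hp3 _ _ hq
      rw [Rat.cast_intCast] at h ⊢
      exact (Int.cast_le.mpr (Int.le_floor.mpr h)).trans (hv (Sum.inr i)).1
    · exact hp3 _ q hq
  · rintro (i | i | i | i) q hq
    · exact hp4 _ q hq
    · obtain ⟨n, rfl⟩ := hu _ (Or.inl (Or.inr (Or.inl ⟨i, rfl⟩))) q hq
      have h := hp4 _ _ hq
      rw [Rat.cast_intCast] at h ⊢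
      exact (hv (Sum.inl i)).2.trans (Int.cast_le.mpr (Int.ceil_le.mpr h))
    · obtain ⟨n, rfl⟩ := hu _ (Or.inr ⟨i, rfl⟩) q hq
      have h := hp4 _ _ hq
      rw [Rat.cast_intCast] at h ⊢
      exact (hv (Sum.inr i)).2.trans (Int.cast_le.mpr (Int.ceil_le.mpr h))
    · exact hp4 _ q hq
  · intro j
    rw [hy, hT, hpT]

lemma fiber_subset_convexHull (M : BlockMILP W1 W2 W3 W4 m₁ m₂) {k : ℕ}
    {S : Matrix (Fin m₁) W2 ℤ} {U : Matrix (Fin m₁) (Fin k) ℤ}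
    {T : Matrix (Fin k) W2 ℤ} {R : Matrix (Fin m₂) (Fin k) ℚ}
    (hB : M.B = S + U * T) (hE : M.E = R * T.map (Int.cast : ℤ → ℚ))
    (hTU : (Matrix.fromBlocks S M.C T 0).IsTotallyUnimodular)
    (hℓ : LowerIntegralOn M.ℓ (M.intVars ∪ M.zVars))
    (hu : UpperIntegralOn M.u (M.intVars ∪ M.zVars))
    (dx : W1 → ℤ) (dT : Fin k → ℤ) (dω : M.W4I → ℤ) :
    M.fiber T dx dT dω
      ⊆ convexHull ℝ (M.fiber T dx dT dω ∩ mixedIntegerSet (M.intVars ∪ M.zVars)) := by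
  intro p hp
  have hmul : ∀ v : W2 ⊕ W3 → ℝ,
      (Matrix.fromBlocks S M.C T 0).map (Int.cast : ℤ → ℝ) *ᵥ v
        = Sum.elim (S.map (Int.cast : ℤ → ℝ) *ᵥ (v ∘ Sum.inl)
            + M.C.map (Int.cast : ℤ → ℝ) *ᵥ (v ∘ Sum.inr))
          (T.map (Int.cast : ℤ → ℝ) *ᵥ (v ∘ Sum.inl)) := by
    intro v
    rw [Matrix.fromBlocks_map, Matrix.fromBlocks_mulVec]
    congr 1
    simp [Matrix.map_zero]
  -- on the fiber, `S y + C z = b - A x - U T y` is integral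
  have hint : ∀ i, ∃ c : ℤ, ((Matrix.fromBlocks S M.C T 0).map (Int.cast : ℤ → ℝ) *ᵥ
      Sum.elim (yPart p) (zPart p)) i = c := by
    obtain ⟨⟨hp1, -⟩, hpx, hpT, -⟩ := hp
    rw [hmul]
    rintro (i | j)
    · refine ⟨(M.b - M.A *ᵥ dx - U *ᵥ dT) i, ?_⟩
      have h := congrFun hp1 i
      rw [show M.B.map (Int.cast : ℤ → ℝ) = S.map (Int.cast : ℤ → ℝ)
          + U.map (Int.cast : ℤ → ℝ) * T.map (Int.cast : ℤ → ℝ) by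
            ext i j; simp [hB, Matrix.mul_apply],
        Matrix.add_mulVec, ← Matrix.mulVec_mulVec, funext hpT, funext hpx] at h
      have hA : (M.A.map (Int.cast : ℤ → ℝ) *ᵥ fun i => (dx i : ℝ)) i = ((M.A *ᵥ dx) i : ℤ) := by
        simp [Matrix.mulVec, dotProduct]
      have hU : (U.map (Int.cast : ℤ → ℝ) *ᵥ fun i => (dT i : ℝ)) i = ((U *ᵥ dT) i : ℤ) := by
        simp [Matrix.mulVec, dotProduct]
      simp only [Pi.add_apply, hA, hU] at h
      simp only [Sum.elim_inl, Sum.elim_comp_inl, Sum.elim_comp_inr, Pi.add_apply, Pi.sub_apply]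
      push_cast
      linear_combination h
    · exact ⟨dT j, by simpa using hpT j⟩
  have hmem := hTU.mem_convexHull_integral _ hint
  have hself : replaceYZ p (Sum.elim (yPart p) (zPart p)) = p := by
    ext (i | i | i | i) <;> rfl
  suffices h : Sum.elim (yPart p) (zPart p) ∈ {v | replaceYZ p v ∈ convexHull ℝ
      (M.fiber T dx dT dω ∩ mixedIntegerSet (M.intVars ∪ M.zVars))} by
    rwa [Set.mem_ofPred_eq, hself] at h
  refine convexHull_min ?_ ?_ hmem
  · rintro v ⟨hvint, hvN, hvb⟩
    rw [hmul, hmul, Sum.elim_eq_iff] at hvN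
    refine subset_convexHull ℝ _
      ⟨M.replaceYZ_mem_fiber hB hE hℓ hu hp hvN.1 hvN.2 hvb, ?_⟩
    rintro w ((⟨i, rfl⟩ | ⟨i, rfl⟩ | ⟨i, hi, rfl⟩) | ⟨i, rfl⟩)
    · exact ⟨dx i, hp.2.1 i⟩
    · exact hvint (Sum.inl i)
    · exact ⟨dω ⟨i, hi⟩, hp.2.2.2 ⟨i, hi⟩⟩
    · exact hvint (Sum.inr i)
  · intro v hv v' hv' a b ha hb hab
    have h : replaceYZ p (a • v + b • v') = a • replaceYZ p v + b • replaceYZ p v' := by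
      ext (i | i | i | i)
      · change xPart p i = a * xPart p i + b * xPart p i
        rw [← add_mul, hab, one_mul]
      · rfl
      · rfl
      · change ωPart p i = a * ωPart p i + b * ωPart p i
        rw [← add_mul, hab, one_mul]
    change replaceYZ p (a • v + b • v') ∈ convexHull ℝ _
    rw [h]
    exact convex_convexHull ℝ _ hv hv' ha hb hab

lemma mem_reformulation_iff (M : BlockMILP W1 W2 W3 W4 m₁ m₂) {k : ℕ} (T : Matrix (Fin k) W2 ℤ)
    (p : Vars W1 W2 W3 W4 → ℝ) :
    p ∈ M.reformulation T ↔ ∃ dx dT dω, p ∈ M.fiber T dx dT dω := by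
  constructor
  · rintro ⟨hp, hx, hT, hω⟩
    choose dx hdx using hx
    choose dT hdT using hT
    choose dω hdω using fun i : M.W4I => hω i i.2
    exact ⟨dx, dT, dω, hp, hdx, hdT, hdω⟩
  · rintro ⟨dx, dT, dω, hp, hx, hT, hω⟩
    exact ⟨hp, fun i => ⟨_, hx i⟩, fun j => ⟨_, hT j⟩, fun i hi => ⟨_, hω ⟨i, hi⟩⟩⟩

lemma inter_mixedIntegerSet_subset_reformulation (M : BlockMILP W1 W2 W3 W4 m₁ m₂) {k : ℕ}
    (T : Matrix (Fin k) W2 ℤ) : M.P ∩ mixedIntegerSet M.intVars ⊆ M.reformulation T := by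
  rintro p ⟨hp, hint⟩
  have hy : ∀ i, ∃ n : ℤ, yPart p i = n := fun i => hint _ (Or.inr (Or.inl ⟨i, rfl⟩))
  choose n hn using hy
  refine ⟨hp, fun i => hint _ (Or.inl ⟨i, rfl⟩), fun j => ⟨(T *ᵥ n) j, ?_⟩,
    fun i hi => hint _ (Or.inr (Or.inr ⟨i, hi, rfl⟩))⟩
  rw [funext hn]
  simp [Matrix.mulVec, dotProduct]

end BlockMILP

lemma mixedIntegerSet_anti {W : Type*} {I J : Set W} (h : I ⊆ J) :
    mixedIntegerSet J ⊆ mixedIntegerSet I :=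
  fun _ hp w hw => hp w (h hw)

theorem mainTheorem4
    {W1 W2 W3 W4 : Type*} [Fintype W1] [Fintype W2] [Fintype W3] [Fintype W4]
    {m₁ m₂ : ℕ} (M : BlockMILP W1 W2 W3 W4 m₁ m₂)
    (k : ℕ) (hk : k ≤ Fintype.card W2)
    (S : Matrix (Fin m₁) W2 ℤ) (U : Matrix (Fin m₁) (Fin k) ℤ)
    (T : Matrix (Fin k) W2 ℤ) (R : Matrix (Fin m₂) (Fin k) ℚ)
    (hB : M.B = S + U * T)
    (hE : M.E = R * T.map (Int.cast : ℤ → ℚ))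
    (hTU : (Matrix.fromBlocks S M.C T 0).IsTotallyUnimodular)
    (hℓ : LowerIntegralOn M.ℓ (M.intVars ∪ M.zVars))
    (hu : UpperIntegralOn M.u (M.intVars ∪ M.zVars)) :
    (∀ (dx : W1 → ℤ) (dT : Fin k → ℤ) (dω : M.W4I → ℤ),
      M.fiber T dx dT dω
          = convexHull ℝ (M.fiber T dx dT dω ∩ mixedIntegerSet M.intVars) ∧
      convexHull ℝ (M.fiber T dx dT dω ∩ mixedIntegerSet M.intVars)
          = convexHull ℝ (M.fiber T dx dT dω ∩ mixedIntegerSet (M.intVars ∪ M.zVars))) ∧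
    convexHull ℝ (M.P ∩ mixedIntegerSet M.intVars)
        = convexHull ℝ (M.P ∩ mixedIntegerSet (M.intVars ∪ M.zVars)) ∧
    convexHull ℝ (M.P ∩ mixedIntegerSet (M.intVars ∪ M.zVars))
        = convexHull ℝ (M.reformulation T) := by
  have hanti : mixedIntegerSet (M.intVars ∪ M.zVars) ⊆ mixedIntegerSet M.intVars :=
    mixedIntegerSet_anti Set.subset_union_left
  have hfiber := M.fiber_subset_convexHull hB hE hTU hℓ hu
  have hPI : convexHull ℝ (M.P ∩ mixedIntegerSet M.intVars)
      ⊆ convexHull ℝ (M.reformulation T) :=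
    convexHull_mono (M.inter_mixedIntegerSet_subset_reformulation T)
  have hPZ : convexHull ℝ (M.P ∩ mixedIntegerSet (M.intVars ∪ M.zVars))
      ⊆ convexHull ℝ (M.P ∩ mixedIntegerSet M.intVars) :=
    convexHull_mono (Set.inter_subset_inter_right _ hanti)
  -- the reformulation is the union of the fibers
  have href : convexHull ℝ (M.reformulation T)
      ⊆ convexHull ℝ (M.P ∩ mixedIntegerSet (M.intVars ∪ M.zVars)) := by
    refine convexHull_min (fun p hp => ?_) (convex_convexHull ℝ _)
    obtain ⟨dx, dT, dω, hpd⟩ := (M.mem_reformulation_iff T p).mp hp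
    exact convexHull_mono (Set.inter_subset_inter_left _ fun q hq => hq.1) (hfiber dx dT dω hpd)
  refine ⟨fun dx dT dω => ?_, (hPI.trans href).antisymm hPZ, (hPZ.trans hPI).antisymm href⟩
  have h1 : convexHull ℝ (M.fiber T dx dT dω ∩ mixedIntegerSet (M.intVars ∪ M.zVars))
      ⊆ convexHull ℝ (M.fiber T dx dT dω ∩ mixedIntegerSet M.intVars) :=
    convexHull_mono (Set.inter_subset_inter_right _ hanti)
  have h2 : convexHull ℝ (M.fiber T dx dT dω ∩ mixedIntegerSet M.intVars)
      ⊆ M.fiber T dx dT dω :=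
    convexHull_min Set.inter_subset_left (M.convex_fiber T dx dT dω)
  exact ⟨((hfiber dx dT dω).trans h1).antisymm h2, (h2.trans (hfiber dx dT dω)).antisymm h1⟩
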